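/- Let $\mathcal X=\{X(n)\}_{n\ge 0}$ be a homogeneous discrete-time Markov chain on a countable state space $S$ with stochastic transition matrix $P$ and arbitrary initial distribution, and suppose that $\mathcal X$ is irreducible and aperiodic. For an $S$-valued chain $\mathcal Y=\{Y(n)\}_{n\ge0}$ and $C\subset S$ let $U(C)=\{Y(n)\in C \text{ for infinitely many } n\}$ and $L(C)=\{Y(n)\in C\text{ for all sufficiently large } n\}$. The set $C$ is *almost closed* for $\mathcal Y$ if $\mathbb P(U(C))>0$ and $U(C)=L(C)$ almost surely; an almost closed set is *atomic* if it does not contain two disjoint almost closed subsets. A *Blackwell decomposition* for $\mathcal Y$ is a finite or countable collection $\{C_1,C_2,\dots\}$ of disjoint almost closed sets such that (i) every $C_i$, except at most one, is atomic; (ii) the nonatomic $C_i$, if present, contains no atomic subset and consists of transient states of $\mathcal Y$; (iii) $\sum_i\mathbb P(L(C_i))=1$. (By a theorem of Blackwell such a decomposition exists and is unique up to sets that are almost surely visited only finitely often.) Let $\beta(\mathcal Y)\in\{1,2,\dots,\infty\}$ be the number of its members. The chain $\mathcal X$ is *simple* if $\beta(\mathcal X)=1$. With $\mathcal X^{(m)}=\{X(nm)\}_{n\ge0}$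 the $m$-step chain, which has transition matrix $P^m$, the *asymptotic period* of a simple chain $\mathcal X$ is $$d(\mathcal X)=\sup\{m\ge1 \mid \beta(\mathcal X^{(m)})=m\}\in\{1,2,\dots,\infty\},$$ and $\mathcal X$ is *asymptotically aperiodic* if $d(\mathcal X)=1$. **Theorem.** Let $\mathcal X$ be as above and simple. If $\mathcal X$ is recurrent, then $\mathcal X$ is asymptotically aperiodic. Hence, if $d(\mathcal X)>1$, then $\mathcal X$ is transient. -/

import Mathlib

open Filter MeasureTheory
open scoped ENNReal

namespace AsymptoticPeriod

variable {S : Type*} {Ω : Type*} [MeasurableSpace Ω]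

/-- The `n`-step transition probabilities `P ^ n` of the stochastic matrix `P`, whose row `i` is
the probability mass function `P i` on the state space. -/
noncomputable def nStep (P : S → PMF S) : ℕ → S → PMF S
  | 0, i => PMF.pure i
  | n + 1, i => (P i).bind (nStep P n)

/-- Every state can be reached from every state. -/
def IsIrreducible (P : S → PMF S) : Prop :=
  ∀ i j : S, ∃ n : ℕ, nStep P n i j ≠ 0

/-- Every state has period one: `1` is the only common divisor of the possible return times. -/
def IsAperiodic (P : S → PMF S) : Prop :=
  ∀ i : S, ∀ d : ℕ, (∀ n : ℕ, 1 ≤ n → nStep P n i i ≠ 0 → d ∣ n) → d = 1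

open Classical in
/-- `firstPassage P j n i` is the probability that the chain started in `i` visits `j` at time
`n + 1` and at none of the times `1, …, n`. -/
noncomputable def firstPassage (P : S → PMF S) (j : S) : ℕ → S → ℝ≥0∞
  | 0, i => P i j
  | n + 1, i => ∑' k : S, if k = j then 0 else P i k * firstPassage P j n k

/-- The probability that the chain started in `i` ever returns to `i`. -/
noncomputable def returnProb (P : S → PMF S) (i : S) : ℝ≥0∞ :=
  ∑' n : ℕ, firstPassage P i n i

def IsRecurrentState (P : S → PMF S) (i : S) : Prop := returnProb P i = 1

def IsTransientState (P : S → PMF S) (i : S) : Prop := returnProb P i < 1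

/-- The chain is recurrent: every state is recurrent. -/
def IsRecurrent (P : S → PMF S) : Prop := ∀ i : S, IsRecurrentState P i

/-- The chain is transient: every state is transient. -/
def IsTransient (P : S → PMF S) : Prop := ∀ i : S, IsTransientState P i

/-- `X` is, under `μ`, a homogeneous Markov chain with transition matrix `P` (and arbitrary
initial distribution). -/
structure IsMarkovChain (P : S → PMF S) (X : ℕ → Ω → S) (μ : Measure Ω) : Prop where
  measurableSet_eq : ∀ (n : ℕ) (s : S), MeasurableSet {ω | X n ω = s}
  markov : ∀ (n : ℕ) (s : ℕ → S),
    μ {ω | ∀ k ≤ n + 1, X k ω = s k} = μ {ω | ∀ k ≤ n, X k ω = s k} * P (s n) (s (n + 1))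

/-- The event `U(C)` that `X n ∈ C` infinitely often. -/
def eventU (X : ℕ → Ω → S) (C : Set S) : Set Ω := {ω | ∃ᶠ n in atTop, X n ω ∈ C}

/-- The event `L(C)` that `X n ∈ C` for all sufficiently large `n`. -/
def eventL (X : ℕ → Ω → S) (C : Set S) : Set Ω := {ω | ∀ᶠ n in atTop, X n ω ∈ C}

/-- Transient sets: `U(C)` is almost surely empty. -/
def IsTransientSet (X : ℕ → Ω → S) (μ : Measure Ω) (C : Set S) : Prop :=
  μ (eventU X C) = 0

/-- Regular sets: `U(C)` and `L(C)` are almost surely equal. -/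
def IsRegularSet (X : ℕ → Ω → S) (μ : Measure Ω) (C : Set S) : Prop :=
  eventU X C =ᵐ[μ] eventL X C

/-- Almost closed sets: regular and not transient. -/
def IsAlmostClosed (X : ℕ → Ω → S) (μ : Measure Ω) (C : Set S) : Prop :=
  ¬ IsTransientSet X μ C ∧ IsRegularSet X μ C

/-- Atomic sets: almost closed sets without two disjoint almost closed subsets. -/
def IsAtomicSet (X : ℕ → Ω → S) (μ : Measure Ω) (C : Set S) : Prop :=
  IsAlmostClosed X μ C ∧
    ¬ ∃ A B : Set S, A ⊆ C ∧ B ⊆ C ∧ IsAlmostClosed X μ A ∧ IsAlmostClosed X μ B ∧ Disjoint A B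

/-- `D` is a Blackwell decomposition of the state space for the chain `X` with transition
matrix `P`. -/
structure IsBlackwellDecomposition (P : S → PMF S) (X : ℕ → Ω → S) (μ : Measure Ω)
    (D : Set (Set S)) : Prop where
  countable : D.Countable
  disjoint : ∀ C ∈ D, ∀ C' ∈ D, C ≠ C' → Disjoint C C'
  almostClosed : ∀ C ∈ D, IsAlmostClosed X μ C
  nonatomic_unique : ∀ C ∈ D, ∀ C' ∈ D, ¬ IsAtomicSet X μ C → ¬ IsAtomicSet X μ C' → C = C'
  nonatomic_no_atomic_subset : ∀ C ∈ D, ¬ IsAtomicSet X μ C → ∀ A ⊆ C, ¬ IsAtomicSet X μ A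
  nonatomic_transient : ∀ C ∈ D, ¬ IsAtomicSet X μ C → ∀ i ∈ C, IsTransientState P i
  sum_eq_one : ∑' C : D, μ (eventL X C) = 1

/-- The number of sets in a Blackwell decomposition. Blackwell decompositions exist and are unique
up to equivalence, so the infimum is over a set with exactly one element. -/
noncomputable def blackwellNumber (P : S → PMF S) (X : ℕ → Ω → S) (μ : Measure Ω) : ℕ∞ :=
  sInf {b : ℕ∞ | ∃ D : Set (Set S), IsBlackwellDecomposition P X μ D ∧ b = D.encard}

/-- The chain is simple: its Blackwell decomposition consists of one set. -/
def IsSimple (P : S → PMF S) (X : ℕ → Ω → S) (μ : Measure Ω) : Prop :=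
  blackwellNumber P X μ = 1

/-- The `m`-step chain `n ↦ X (n * m)`; its transition matrix is `P ^ m`. -/
def skeleton (X : ℕ → Ω → S) (m : ℕ) : ℕ → Ω → S := fun n => X (n * m)

/-- The asymptotic period: the supremum, possibly infinite, of the `m ≥ 1` for which the `m`-step
chain has exactly `m` Blackwell components. -/
noncomputable def asymptoticPeriod (P : S → PMF S) (X : ℕ → Ω → S) (μ : Measure Ω) : ℕ∞ :=
  sSup {d : ℕ∞ | ∃ m : ℕ, 1 ≤ m ∧ blackwellNumber (nStep P m) (skeleton X m) μ = m ∧ d = m}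

/-- The chain is asymptotically aperiodic. -/
def IsAsymptoticallyAperiodic (P : S → PMF S) (X : ℕ → Ω → S) (μ : Measure Ω) : Prop :=
  asymptoticPeriod P X μ = 1

end AsymptoticPeriod

namespace AsymptoticPeriod

/-! ### Transition probabilities -/

section Chain

variable {S : Type*}

/-! For an irreducible aperiodic recurrent chain, every `m`-step chain with `m ≥ 1` is again
irreducible with infinite Green function, so it almost surely visits each state infinitely often.
Any almost closed set of the `m`-step chain is nonempty, hence visited infinitely often and, by
regularity, eventually never left. Two disjoint sets cannot both have this property, so no Blackwell
decomposition has `m > 1` members. This is `blackwellNumber_skeleton_ne`, resting on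
`green_nStep_eq_top` and `iSup_hitBy_eq_one`. The second claim adds the recurrence/transience
dichotomy for irreducible chains. -/

theorem nStep_add (P : S → PMF S) (a b : ℕ) (i : S) :
    nStep P (a + b) i = (nStep P a i).bind (nStep P b) := by
  induction a generalizing i with
  | zero => simp [nStep, PMF.pure_bind]
  | succ a ih =>
    rw [Nat.succ_add_eq_add_succ, Nat.add_succ]
    simp only [nStep, PMF.bind_bind]
    congr 1
    funext k
    exact ih k

theorem nStep_one (P : S → PMF S) : nStep P 1 = P := by
  funext i
  simp [nStep, PMF.bind_pure]

theorem nStep_nStep (P : S → PMF S) (m n : ℕ) (i : S) :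
    nStep (nStep P m) n i = nStep P (n * m) i := by
  induction n generalizing i with
  | zero => simp [nStep]
  | succ n ih =>
    have h : nStep (nStep P m) n = nStep P (n * m) := funext ih
    rw [Nat.succ_mul, Nat.add_comm (n * m), nStep_add P, ← h]
    rfl

theorem nStep_add_apply (P : S → PMF S) (a b : ℕ) (i j : S) :
    nStep P (a + b) i j = ∑' k, nStep P a i k * nStep P b k j := by
  rw [nStep_add, PMF.bind_apply]

theorem nStep_mul_nStep_le (P : S → PMF S) (a b : ℕ) (i k j : S) :
    nStep P a i k * nStep P b k j ≤ nStep P (a + b) i j := by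
  rw [nStep_add_apply]
  exact ENNReal.le_tsum (f := fun k => nStep P a i k * nStep P b k j) k

theorem nStep_add_ne_zero {P : S → PMF S} {a b : ℕ} {i k j : S} (h₁ : nStep P a i k ≠ 0)
    (h₂ : nStep P b k j ≠ 0) : nStep P (a + b) i j ≠ 0 := fun h =>
  mul_ne_zero h₁ h₂ (le_antisymm (h ▸ nStep_mul_nStep_le P a b i k j) bot_le)

/-- Return times form an additive semigroup of gcd one, which contains all large integers. -/
theorem eventually_nStep_self_ne_zero {P : S → PMF S} (haper : IsAperiodic P) (i : S) :
    ∃ N, ∀ n ≥ N, nStep P n i i ≠ 0 := by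
  obtain ⟨N, hN⟩ := Nat.exists_mem_closure_of_ge {n | 1 ≤ n ∧ nStep P n i i ≠ 0}
  have hg : Nat.setGcd {n | 1 ≤ n ∧ nStep P n i i ≠ 0} = 1 :=
    haper i _ fun n hn h => Nat.setGcd_dvd_of_mem ⟨hn, h⟩
  refine ⟨N, fun n hn => ?_⟩
  have hmem := hN n hn (by simp [hg])
  clear hn
  induction hmem using AddSubmonoid.closure_induction with
  | mem x hx => exact hx.2
  | zero => simp [nStep]
  | add x y _ _ hx hy => exact nStep_add_ne_zero hx hy

theorem eventually_nStep_ne_zero {P : S → PMF S} (hirr : IsIrreducible P)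
    (haper : IsAperiodic P) (i j : S) : ∃ N, ∀ n ≥ N, nStep P n i j ≠ 0 := by
  obtain ⟨a, ha⟩ := hirr i j
  obtain ⟨N, hN⟩ := eventually_nStep_self_ne_zero haper j
  refine ⟨a + N, fun n hn => ?_⟩
  obtain ⟨b, rfl⟩ := Nat.exists_eq_add_of_le (show a ≤ n by omega)
  exact nStep_add_ne_zero ha (hN b (by omega))

/-! ### First passages and the Green function -/

/-- The expected number of visits to `i`, including time `0`, of the chain started in `i`. -/
noncomputable def green (P : S → PMF S) (i : S) : ℝ≥0∞ := ∑' n, nStep P n i i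

/-- Split by the first visit to `j`, at time `x.1 + 1`; hence the antidiagonal of `n`, not `n + 1`.
-/
theorem nStep_succ_eq_sum_firstPassage (P : S → PMF S) (j : S) (n : ℕ) (i : S) :
    nStep P (n + 1) i j =
      ∑ x ∈ Finset.HasAntidiagonal.antidiagonal n, firstPassage P j x.1 i * nStep P x.2 j j := by
  classical
  induction n generalizing i with
  | zero => simp [firstPassage, nStep]
  | succ n ih =>
    rw [Finset.Nat.sum_antidiagonal_succ]
    have h : nStep P (n + 1 + 1) i j = ∑' k, P i k * nStep P (n + 1) k j := rfl
    rw [h, ENNReal.tsum_eq_add_tsum_ite j]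
    congr 1
    simp only [firstPassage, ← ENNReal.tsum_mul_right]
    rw [← Summable.tsum_finsetSum fun _ _ => ENNReal.summable]
    refine tsum_congr fun k => ?_
    split_ifs with hk
    · simp
    · rw [ih, Finset.mul_sum]
      simp only [mul_assoc]

theorem sum_firstPassage_le_one (P : S → PMF S) (j : S) (N : ℕ) (i : S) :
    ∑ n ∈ Finset.range N, firstPassage P j n i ≤ 1 := by
  classical
  induction N generalizing i with
  | zero => simp
  | succ N ih =>
    rw [Finset.sum_range_succ']
    simp only [firstPassage]
    rw [← Summable.tsum_finsetSum fun _ _ => ENNReal.summable, add_comm, ← (P i).tsum_coe,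
      ENNReal.tsum_eq_add_tsum_ite (f := P i) j]
    refine add_le_add_right (ENNReal.tsum_le_tsum fun k => ?_) _
    split_ifs with hk
    · simp
    · rw [← Finset.mul_sum]
      exact mul_le_of_le_one_right' (ih k)

theorem returnProb_le_one (P : S → PMF S) (i : S) : returnProb P i ≤ 1 := by
  rw [returnProb, ENNReal.tsum_eq_iSup_nat]
  exact iSup_le fun N => sum_firstPassage_le_one P i N i

theorem _root_.ENNReal.tsum_sum_antidiagonal_mul (f g : ℕ → ℝ≥0∞) :
    ∑' n, ∑ x ∈ Finset.HasAntidiagonal.antidiagonal n, f x.1 * g x.2 = (∑' n, f n) * ∑' n, g n := by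
  have h := Finset.HasAntidiagonal.sigmaAntidiagonalEquivProd.tsum_eq (fun x : ℕ × ℕ => f x.1 * g x.2)
  rw [ENNReal.tsum_sigma', ENNReal.tsum_prod (f := fun a b => f a * g b)] at h
  simp only [ENNReal.tsum_mul_left, ENNReal.tsum_mul_right] at h
  rw [← h]
  refine tsum_congr fun n => ?_
  rw [tsum_fintype, ← Finset.sum_coe_sort]
  rfl

theorem green_eq (P : S → PMF S) (i : S) : green P i = 1 + returnProb P i * green P i := by
  conv_lhs => rw [green, tsum_eq_zero_add' ENNReal.summable]
  simp only [nStep_succ_eq_sum_firstPassage]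
  rw [ENNReal.tsum_sum_antidiagonal_mul (fun n => firstPassage P i n i) fun n => nStep P n i i,
    ← green, ← returnProb]
  simp [nStep]

theorem green_eq_top_of_returnProb_eq_one {P : S → PMF S} {i : S} (h : returnProb P i = 1) :
    green P i = ∞ := by
  have := green_eq P i
  rw [h, one_mul] at this
  by_contra hne
  exact absurd this.symm.le (not_le.2 (by
    rw [add_comm]; exact ENNReal.lt_add_right hne one_ne_zero))

/-- A truncated `green_eq`: the full equation is also satisfied by `∞`, so finiteness must come from
partial sums. -/
theorem sum_nStep_le (P : S → PMF S) (i : S) (N : ℕ) :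
    ∑ n ∈ Finset.range N, nStep P n i i ≤
      1 + returnProb P i * ∑ n ∈ Finset.range N, nStep P n i i := by
  classical
  cases N with
  | zero => simp
  | succ N =>
    have h0 : nStep P 0 i i = 1 := by simp [nStep]
    conv_lhs => rw [Finset.sum_range_succ', add_comm, h0]
    refine add_le_add_right ?_ 1
    -- Cutting the sequence off makes the right side a full Cauchy product.
    let p : ℕ → ℝ≥0∞ := fun l => if l ∈ Finset.range (N + 1) then nStep P l i i else 0
    have hp : ∑ n ∈ Finset.range (N + 1), nStep P n i i = ∑' l, p l := by
      rw [tsum_eq_sum (s := Finset.range (N + 1)) (fun l hl => if_neg hl)]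
      exact Finset.sum_congr rfl fun l hl => (if_pos hl).symm
    rw [hp, returnProb, ← ENNReal.tsum_sum_antidiagonal_mul]
    refine le_trans (Finset.sum_le_sum fun n hn => ?_) (ENNReal.sum_le_tsum (Finset.range N))
    rw [nStep_succ_eq_sum_firstPassage]
    refine Finset.sum_le_sum fun x hx => ?_
    have : x.2 ∈ Finset.range (N + 1) := by
      have := Finset.HasAntidiagonal.mem_antidiagonal.1 hx
      have := Finset.mem_range.1 hn
      exact Finset.mem_range.2 (by omega)
    simp only [p, if_pos this, le_refl]

theorem green_ne_top_of_returnProb_lt_one {P : S → PMF S} {i : S} (h : returnProb P i < 1) :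
    green P i ≠ ∞ := by
  have hbound : green P i ≤ (1 - returnProb P i)⁻¹ := by
    rw [green, ENNReal.tsum_eq_iSup_nat]
    refine iSup_le fun N => ?_
    have hfin : ∑ n ∈ Finset.range N, nStep P n i i ≠ ∞ :=
      ENNReal.sum_ne_top.2 fun n _ => PMF.apply_ne_top _ _
    rw [← one_div, ENNReal.le_div_iff_mul_le (Or.inl (tsub_pos_of_lt h).ne')
      (Or.inl (ENNReal.sub_ne_top ENNReal.one_ne_top)), ENNReal.mul_sub (fun _ _ => hfin), mul_one,
      tsub_le_iff_right, mul_comm _ (returnProb P i)]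
    exact sum_nStep_le P i N
  exact ne_top_of_le_ne_top (ENNReal.inv_ne_top.2 (tsub_pos_of_lt h).ne') hbound

/-- Loops at `i` extend to loops at `j` along fixed paths from `j` to `i` and back. -/
theorem green_eq_top_of_green_eq_top {P : S → PMF S} (hirr : IsIrreducible P) {i : S} (j : S)
    (h : green P i = ∞) : green P j = ∞ := by
  obtain ⟨a, ha⟩ := hirr j i
  obtain ⟨b, hb⟩ := hirr i j
  have key : nStep P a j i * green P i * nStep P b i j ≤ green P j := by
    rw [green, ← ENNReal.tsum_mul_left, ← ENNReal.tsum_mul_right]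
    refine le_trans (ENNReal.tsum_le_tsum fun n => ?_)
      (ENNReal.tsum_comp_le_tsum_of_injective (f := fun n : ℕ => a + n + b)
        (fun x y hxy => by simpa using hxy) (fun n => nStep P n j j))
    exact le_trans (mul_le_mul_left (nStep_mul_nStep_le P a n j i i) _)
      (nStep_mul_nStep_le P (a + n) b j i j)
  rw [h, ENNReal.mul_top ha, ENNReal.top_mul hb] at key
  exact top_le_iff.1 key

theorem isTransient_of_not_isRecurrent {P : S → PMF S} (hirr : IsIrreducible P)
    (h : ¬ IsRecurrent P) : IsTransient P := by
  simp only [IsRecurrent, IsRecurrentState, not_forall] at h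
  obtain ⟨i, hi⟩ := h
  have hi' := lt_of_le_of_ne (returnProb_le_one P i) hi
  intro j
  refine lt_of_le_of_ne (returnProb_le_one P j) fun hj => ?_
  exact green_ne_top_of_returnProb_lt_one hi'
    (green_eq_top_of_green_eq_top hirr i (green_eq_top_of_returnProb_eq_one hj))

/-- By aperiodicity, a loop of suitable length carries each residue class mod `m` into class `0`. If
class `0` had a finite sum, all `m` classes would, and so would `green P i`. -/
theorem green_nStep_eq_top {P : S → PMF S} (haper : IsAperiodic P) {i : S}
    (h : green P i = ∞) {m : ℕ} (hm : m ≠ 0) : green (nStep P m) i = ∞ := by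
  have : NeZero m := ⟨hm⟩
  simp only [green, nStep_nStep]
  by_contra hfin
  obtain ⟨N, hN⟩ := eventually_nStep_self_ne_zero haper i
  have hres : ∀ r : Fin m, ∑' n : ℕ, nStep P (n * m + r) i i ≠ ∞ := by
    intro r htop
    have hr : (r : ℕ) < m := r.2
    obtain ⟨c, b, hb, hc⟩ : ∃ c b : ℕ, N ≤ b ∧ r + b = c * m := by
      refine ⟨N + 1, (N + 1) * m - r, ?_, ?_⟩
      · have : N * 1 ≤ N * m := Nat.mul_le_mul_left N (by omega)
        rw [Nat.succ_mul]; omega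
      · have : m ≤ (N + 1) * m := Nat.le_mul_of_pos_left m (by omega)
        omega
    have key : (∑' n : ℕ, nStep P (n * m + r) i i) * nStep P b i i ≤
        ∑' n : ℕ, nStep P (n * m) i i := by
      rw [← ENNReal.tsum_mul_right]
      refine le_trans (ENNReal.tsum_le_tsum fun n => ?_)
        (ENNReal.tsum_comp_le_tsum_of_injective (f := fun n : ℕ => n + c)
          (add_left_injective c) (fun n => nStep P (n * m) i i))
      refine (nStep_mul_nStep_le P (n * m + r) b i i i).trans_eq ?_
      rw [Nat.add_assoc, hc, ← Nat.add_mul]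
    rw [htop, ENNReal.top_mul (hN b hb)] at key
    exact hfin (top_le_iff.1 key)
  have hsum := (Nat.divModEquiv m).symm.tsum_eq (fun n => nStep P n i i)
  rw [← green, h, ENNReal.tsum_prod (f := fun a b => nStep P ((Nat.divModEquiv m).symm (a, b)) i i),
    ENNReal.tsum_comm, tsum_fintype] at hsum
  refine ENNReal.sum_ne_top.2 (fun r _ => ?_) hsum
  simpa [Nat.divModEquiv] using hres r

/-! ### Superharmonic functions and hitting probabilities -/

theorem tsum_mul_le_one (p : PMF S) {h : S → ℝ≥0∞} (h1 : ∀ i, h i ≤ 1) :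
    ∑' k, p k * h k ≤ 1 :=
  (ENNReal.tsum_le_tsum fun k => mul_le_of_le_one_right' (h1 k)).trans_eq p.tsum_coe

theorem tsum_nStep_succ_mul (Q : S → PMF S) (n : ℕ) (i : S) (h : S → ℝ≥0∞) :
    ∑' k, nStep Q (n + 1) i k * h k = ∑' l, nStep Q n i l * ∑' k, Q l k * h k := by
  simp only [nStep_add_apply, nStep_one, ← ENNReal.tsum_mul_right, ← ENNReal.tsum_mul_left]
  rw [ENNReal.tsum_comm]
  simp only [mul_assoc]

/-- Telescoping the defect `g = h - Qh` bounds `green Q i * g i` by `h i ≤ 1`, so an infinite Green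
function forces `g i = 0`. -/
theorem harmonic_of_superharmonic {Q : S → PMF S} (hQ : ∀ i, green Q i = ∞) {h : S → ℝ≥0∞}
    (h1 : ∀ i, h i ≤ 1) (hsup : ∀ i, ∑' k, Q i k * h k ≤ h i) (i : S) :
    ∑' k, Q i k * h k = h i := by
  set g : S → ℝ≥0∞ := fun l => h l - ∑' k, Q l k * h k with hg
  have hdecomp : ∀ N : ℕ, ∑' k, nStep Q N i k * h k +
      ∑ n ∈ Finset.range N, ∑' l, nStep Q n i l * g l = h i := by
    intro N
    induction N with
    | zero =>
      simp only [nStep, Finset.range_zero, Finset.sum_empty, add_zero]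
      rw [tsum_eq_single i fun k hk => by simp [PMF.pure_apply, hk]]
      simp
    | succ N ih =>
      rw [Finset.sum_range_succ, ← ih, tsum_nStep_succ_mul,
        add_comm (∑ n ∈ Finset.range N, _), ← add_assoc, ← ENNReal.tsum_add]
      congr 1
      refine tsum_congr fun l => ?_
      rw [← mul_add, hg, add_tsub_cancel_of_le (hsup l)]
  have hle : green Q i * g i ≤ 1 := by
    rw [green, ENNReal.tsum_eq_iSup_nat, ENNReal.iSup_mul]
    refine iSup_le fun N => le_trans ?_ (h1 i)
    rw [← hdecomp N, Finset.sum_mul]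
    refine le_add_left (Finset.sum_le_sum fun n _ => ?_)
    exact ENNReal.le_tsum (f := fun l => nStep Q n i l * g l) i
  have hgi : g i = 0 := by
    by_contra hne
    rw [hQ, ENNReal.top_mul hne] at hle
    exact absurd hle (by simp)
  exact le_antisymm (hsup i) (tsub_eq_zero_iff_le.1 hgi)

/-- Maximum principle: `h j = 1` is an average of values at most `1` over states reachable from `j`.
-/
theorem eq_one_of_superharmonic {Q : S → PMF S} (hirr : IsIrreducible Q)
    (hQ : ∀ i, green Q i = ∞) {h : S → ℝ≥0∞} (h1 : ∀ i, h i ≤ 1)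
    (hsup : ∀ i, ∑' k, Q i k * h k ≤ h i) {j : S} (hj : h j = 1) (i : S) : h i = 1 := by
  have hn : ∀ n : ℕ, ∑' k, nStep Q n j k * h k = 1 := by
    intro n
    induction n with
    | zero =>
      simp only [nStep]
      rw [tsum_eq_single j fun k hk => by simp [PMF.pure_apply, hk]]
      simp [hj]
    | succ n ih =>
      rw [tsum_nStep_succ_mul]
      simpa only [harmonic_of_superharmonic hQ h1 hsup] using ih
  obtain ⟨n, hne⟩ := hirr j i
  by_contra hi
  have hlt : ∑' k, nStep Q n j k * h k < ∑' k, nStep Q n j k := by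
    refine ENNReal.tsum_lt_tsum (i := i) (by rw [hn]; simp)
      (fun k => mul_le_of_le_one_right' (h1 k)) ?_
    conv_rhs => rw [← mul_one (nStep Q n j i)]
    exact ENNReal.mul_lt_mul_right hne (PMF.apply_ne_top _ _) (lt_of_le_of_ne (h1 i) hi)
  rw [hn, PMF.tsum_coe] at hlt
  exact lt_irrefl _ hlt

open Classical in
/-- The probability that the chain started in `i` visits `j` at one of the times `0, …, n`. -/
noncomputable def hitBy (Q : S → PMF S) (j : S) : ℕ → S → ℝ≥0∞
  | 0, i => if i = j then 1 else 0
  | n + 1, i => if i = j then 1 else ∑' k, Q i k * hitBy Q j n k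

theorem hitBy_self (Q : S → PMF S) (j : S) (n : ℕ) : hitBy Q j n j = 1 := by
  cases n <;> simp [hitBy]

theorem hitBy_le_one (Q : S → PMF S) (j : S) (n : ℕ) (i : S) : hitBy Q j n i ≤ 1 := by
  induction n generalizing i with
  | zero => simp only [hitBy]; split_ifs <;> simp
  | succ n ih =>
    simp only [hitBy]
    split_ifs
    · exact le_rfl
    · exact tsum_mul_le_one _ ih

theorem hitBy_monotone (Q : S → PMF S) (j i : S) : Monotone fun n => hitBy Q j n i := by
  refine monotone_nat_of_le_succ fun n => ?_
  induction n generalizing i with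
  | zero =>
    simp only [hitBy]
    split_ifs <;> simp
  | succ n ih =>
    rw [hitBy, hitBy]
    split_ifs
    · exact le_rfl
    · exact ENNReal.tsum_le_tsum fun k => mul_le_mul_right (ih k) _

theorem _root_.ENNReal.tsum_iSup_of_monotone {ι : Type*} {f : ι → ℕ → ℝ≥0∞}
    (hf : ∀ i, Monotone (f i)) : ∑' i, ⨆ n, f i n = ⨆ n, ∑' i, f i n := by
  simp only [ENNReal.tsum_eq_iSup_sum]
  rw [iSup_comm]
  exact iSup_congr fun s => ENNReal.finsetSum_iSup_of_monotone fun i => hf i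

/-- The probability of ever hitting `j` is superharmonic and attains its maximum `1` at `j`. -/
theorem iSup_hitBy_eq_one {Q : S → PMF S} (hirr : IsIrreducible Q) (hQ : ∀ i, green Q i = ∞)
    (j i : S) : ⨆ n, hitBy Q j n i = 1 := by
  refine eq_one_of_superharmonic hirr hQ (h := fun i => ⨆ n, hitBy Q j n i)
    (fun i => iSup_le fun n => hitBy_le_one Q j n i) (fun i => ?_) (j := j) ?_ i
  · by_cases hij : i = j
    · subst hij
      simp only [hitBy_self, ciSup_const]
      exact tsum_mul_le_one _ fun k => iSup_le fun n => hitBy_le_one Q i n k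
    · simp only [ENNReal.mul_iSup]
      rw [ENNReal.tsum_iSup_of_monotone (f := fun k n => Q i k * hitBy Q j n k) fun k a b hab =>
        mul_le_mul_right (hitBy_monotone Q j k hab) _]
      refine iSup_le fun n => le_iSup_of_le (n + 1) ?_
      simp [hitBy, hij]
  · simp [hitBy_self]

end Chain

/-! ### The Markov property -/

section SamplePaths

variable {S : Type*} {Ω : Type*}

/-- Events determined by the values of the process at the times `0, …, n`. -/
def IsPast (X : ℕ → Ω → S) (n : ℕ) (A : Set Ω) : Prop :=
  ∀ ω ω', (∀ k ≤ n, X k ω = X k ω') → ω ∈ A → ω' ∈ A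

theorem IsPast.mono {X : ℕ → Ω → S} {n n' : ℕ} {A : Set Ω} (h : IsPast X n A) (hn : n ≤ n') :
    IsPast X n' A := fun ω ω' hk => h ω ω' fun k hkn => hk k (hkn.trans hn)

theorem IsPast.inter {X : ℕ → Ω → S} {n : ℕ} {A B : Set Ω} (hA : IsPast X n A)
    (hB : IsPast X n B) : IsPast X n (A ∩ B) := fun ω ω' hk h =>
  ⟨hA ω ω' hk h.1, hB ω ω' hk h.2⟩

theorem isPast_eq (X : ℕ → Ω → S) (n : ℕ) (i : S) : IsPast X n {ω | X n ω = i} :=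
  fun _ _ hk h => (hk n le_rfl).symm.trans h

variable [MeasurableSpace Ω] {μ : Measure Ω} {P : S → PMF S} {X : ℕ → Ω → S}

/-- Only the fibers need be measurable: restricting `μ` to `A` allows arbitrary `A`, which spares
measurability proofs for past events. -/
theorem measure_eq_tsum_of_fiber {ι : Type*} [Countable ι] (μ : Measure Ω) (f : Ω → ι)
    (hf : ∀ i, MeasurableSet {ω | f ω = i}) (A : Set Ω) :
    μ A = ∑' i, μ (A ∩ {ω | f ω = i}) := by
  have hU : ⋃ i, {ω | f ω = i} = Set.univ := by ext ω; simp
  have hd : Pairwise (Function.onFun Disjoint fun i => {ω | f ω = i}) := fun i j hij =>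
    Set.disjoint_left.2 fun ω hi hj => hij (hi.symm.trans hj)
  have h := measure_iUnion (μ := μ.restrict A) hd hf
  rw [hU, Measure.restrict_apply_univ] at h
  rw [h]
  exact tsum_congr fun i => by rw [Measure.restrict_apply (hf i), Set.inter_comm]

theorem IsMarkovChain.measurableSet_path (hX : IsMarkovChain P X μ) (n : ℕ)
    (s : Fin (n + 1) → S) : MeasurableSet {ω | (fun k : Fin (n + 1) => X k ω) = s} := by
  have : {ω | (fun k : Fin (n + 1) => X k ω) = s} = ⋂ k : Fin (n + 1), {ω | X k ω = s k} := by
    ext ω; simp [funext_iff]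
  rw [this]
  exact MeasurableSet.iInter fun k => hX.measurableSet_eq _ _

variable [Countable S]

theorem IsMarkovChain.measure_inter_succ (hX : IsMarkovChain P X μ) {n : ℕ} {A : Set Ω}
    (hA : IsPast X n A) {i : S} (hi : ∀ ω ∈ A, X n ω = i) (j : S) :
    μ (A ∩ {ω | X (n + 1) ω = j}) = μ A * P i j := by
  rw [measure_eq_tsum_of_fiber μ _ (hX.measurableSet_path n) (A ∩ _),
    measure_eq_tsum_of_fiber μ _ (hX.measurableSet_path n) A, ← ENNReal.tsum_mul_right]
  refine tsum_congr fun s => ?_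
  by_cases h : ∃ ω₀ ∈ A, (fun k : Fin (n + 1) => X k ω₀) = s
  · obtain ⟨ω₀, hω₀, rfl⟩ := h
    have hpath : ∀ ω, (fun k : Fin (n + 1) => X k ω) = (fun k : Fin (n + 1) => X k ω₀) ↔
        ∀ k ≤ n, X k ω = X k ω₀ := fun ω =>
      ⟨fun h k hk => congrFun h ⟨k, Nat.lt_succ_of_le hk⟩,
        fun h => funext fun k => h k (Nat.le_of_lt_succ k.2)⟩
    -- On a fixed path up to time `n`, a past event is all or nothing, so each nonempty piece is a
    -- cylinder.
    have hm := hX.markov n (fun k => if k ≤ n then X k ω₀ else j)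
    simp only [le_refl, if_true, hi ω₀ hω₀, Nat.not_succ_le_self, if_false] at hm
    convert hm using 2
    · ext ω
      simp only [Set.mem_inter_iff, Set.mem_ofPred_eq, hpath]
      constructor
      · rintro ⟨⟨-, h₁⟩, h₂⟩ k hk
        split_ifs with hkn
        · exact h₂ k hkn
        · rwa [show k = n + 1 by omega]
      · intro h
        have h₂ : ∀ k ≤ n, X k ω = X k ω₀ := fun k hk => by
          simpa [hk] using h k (by omega)
        exact ⟨⟨hA ω₀ ω (fun k hk => (h₂ k hk).symm) hω₀, by simpa using h (n + 1) le_rfl⟩, h₂⟩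
    · congr 1
      ext ω
      simp only [Set.mem_inter_iff, Set.mem_ofPred_eq, hpath]
      constructor
      · rintro ⟨-, h₂⟩ k hk
        simpa [hk] using h₂ k hk
      · intro h
        have h₂ : ∀ k ≤ n, X k ω = X k ω₀ := fun k hk => by
          simpa [hk] using h k hk
        exact ⟨hA ω₀ ω (fun k hk => (h₂ k hk).symm) hω₀, h₂⟩
  · have hempty : A ∩ {ω | (fun k : Fin (n + 1) => X k ω) = s} = ∅ :=
      Set.eq_empty_iff_forall_notMem.2 fun ω hω => h ⟨ω, hω.1, hω.2⟩
    rw [Set.inter_right_comm, hempty]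
    simp

theorem IsMarkovChain.measure_inter_add (hX : IsMarkovChain P X μ) (m : ℕ) {n : ℕ} {A : Set Ω}
    (hA : IsPast X n A) {i : S} (hi : ∀ ω ∈ A, X n ω = i) (j : S) :
    μ (A ∩ {ω | X (n + m) ω = j}) = μ A * nStep P m i j := by
  induction m generalizing n A i with
  | zero =>
    by_cases hij : j = i
    · subst hij
      rw [Nat.add_zero, show A ∩ {ω | X n ω = j} = A from Set.inter_eq_left.2 hi]
      simp [nStep]
    · have hempty : A ∩ {ω | X (n + 0) ω = j} = ∅ :=
        Set.eq_empty_iff_forall_notMem.2 fun ω hω => hij (hω.2.symm.trans (hi ω hω.1))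
      rw [hempty]
      simp [nStep, PMF.pure_apply, hij]
  | succ m ih =>
    rw [measure_eq_tsum_of_fiber μ _ (hX.measurableSet_eq (n + 1))]
    simp only [nStep, PMF.bind_apply, ← ENNReal.tsum_mul_left]
    refine tsum_congr fun k => ?_
    have := ih ((hA.mono n.le_succ).inter (isPast_eq X (n + 1) k)) (i := k) fun ω hω => hω.2
    rw [Set.inter_right_comm, ← mul_assoc, ← hX.measure_inter_succ hA hi k, ← this,
      Nat.succ_add_eq_add_succ]

/-- First-step analysis in blocks of `m`, matching the recursion of `hitBy`. -/
theorem IsMarkovChain.measure_inter_hit (hX : IsMarkovChain P X μ) (m : ℕ) (j : S) (t : ℕ)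
    {n : ℕ} {A : Set Ω} (hA : IsPast X n A) {i : S} (hi : ∀ ω ∈ A, X n ω = i) :
    μ (A ∩ {ω | ∃ r ≤ t, X (n + r * m) ω = j}) = μ A * hitBy (nStep P m) j t i := by
  by_cases hij : i = j
  · subst hij
    rw [hitBy_self, mul_one, Set.inter_eq_left.2]
    exact fun ω hω => ⟨0, Nat.zero_le _, by simpa using hi ω hω⟩
  induction t generalizing n A i with
  | zero =>
    have hempty : A ∩ {ω | ∃ r ≤ 0, X (n + r * m) ω = j} = ∅ := by
      refine Set.eq_empty_iff_forall_notMem.2 ?_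
      rintro ω ⟨hω, r, hr, h⟩
      obtain rfl : r = 0 := by omega
      exact hij ((hi ω hω).symm.trans (by simpa using h))
    rw [hempty]
    simp [hitBy, hij]
  | succ t ih =>
    have hshift : A ∩ {ω | ∃ r ≤ t + 1, X (n + r * m) ω = j} =
        A ∩ {ω | ∃ r ≤ t, X (n + m + r * m) ω = j} := by
      ext ω
      refine and_congr_right fun hω => ⟨?_, ?_⟩
      · rintro ⟨r, hr, h⟩
        cases r with
        | zero => exact absurd ((hi ω hω).symm.trans (by simpa using h)) hij
        | succ r => exact ⟨r, by omega, by rw [← h]; congr 1; ring⟩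
      · rintro ⟨r, hr, h⟩
        exact ⟨r + 1, by omega, by rw [← h]; congr 1; ring⟩
    rw [hshift, measure_eq_tsum_of_fiber μ _ (hX.measurableSet_eq (n + m))]
    simp only [hitBy, if_neg hij, ← ENNReal.tsum_mul_left]
    refine tsum_congr fun k => ?_
    rw [Set.inter_right_comm, ← mul_assoc, ← hX.measure_inter_add m hA hi k]
    have hpast := (hA.mono (Nat.le_add_right n m)).inter (isPast_eq X (n + m) k)
    by_cases hkj : k = j
    · subst hkj
      rw [hitBy_self, mul_one, Set.inter_eq_left.2]
      exact fun ω hω => ⟨0, Nat.zero_le _, by simpa using hω.2⟩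
    · exact ih hpast (fun ω hω => hω.2) hkj

/-! ### Skeletons of recurrent chains -/

theorem IsMarkovChain.ae_exists_skeleton_eq [IsProbabilityMeasure μ] (hX : IsMarkovChain P X μ)
    (hirr : IsIrreducible P) (haper : IsAperiodic P) (hrec : IsRecurrent P) {m : ℕ} (hm : m ≠ 0)
    (j : S) (n : ℕ) : ∀ᵐ ω ∂μ, ∃ r, X (n + r * m) ω = j := by
  have hQirr : IsIrreducible (nStep P m) := fun i k => by
    obtain ⟨N, hN⟩ := eventually_nStep_ne_zero hirr haper i k
    exact ⟨N, by rw [nStep_nStep]; exact hN _ (Nat.le_mul_of_pos_right N (by omega))⟩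
  have hQ : ∀ i, green (nStep P m) i = ∞ := fun i =>
    green_nStep_eq_top haper (green_eq_top_of_returnProb_eq_one (hrec i)) hm
  have hmeas : MeasurableSet {ω | ∃ r, X (n + r * m) ω = j} := by
    rw [Set.ofPred_exists]
    exact MeasurableSet.iUnion fun r => hX.measurableSet_eq _ _
  -- Probability one is checked separately on each event `X n = i`, as the limit of hitting within
  -- `t` blocks.
  refine (prob_compl_eq_zero_iff hmeas).2 (le_antisymm prob_le_one ?_)
  rw [measure_eq_tsum_of_fiber μ _ (hX.measurableSet_eq n),
    ← measure_univ (μ := μ), measure_eq_tsum_of_fiber μ _ (hX.measurableSet_eq n) Set.univ]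
  refine ENNReal.tsum_le_tsum fun i => ?_
  rw [Set.univ_inter]
  conv_lhs => rw [← mul_one (μ _), ← iSup_hitBy_eq_one hQirr hQ j i, ENNReal.mul_iSup]
  refine iSup_le fun t => ?_
  rw [← hX.measure_inter_hit m j t (isPast_eq X n i) fun ω hω => hω]
  refine measure_mono ?_
  rintro ω ⟨hω, r, -, h⟩
  exact ⟨⟨r, h⟩, hω⟩

theorem IsMarkovChain.ae_frequently_skeleton_eq [IsProbabilityMeasure μ]
    (hX : IsMarkovChain P X μ) (hirr : IsIrreducible P) (haper : IsAperiodic P)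
    (hrec : IsRecurrent P) {m : ℕ} (hm : m ≠ 0) (j : S) :
    ∀ᵐ ω ∂μ, ∃ᶠ n in atTop, skeleton X m n ω = j := by
  have h := ae_all_iff.2 fun n => hX.ae_exists_skeleton_eq hirr haper hrec hm j (n * m)
  filter_upwards [h] with ω hω
  refine frequently_atTop.2 fun n => ?_
  obtain ⟨r, hr⟩ := hω n
  exact ⟨n + r, by omega, by rw [← hr, skeleton, Nat.add_mul]⟩

theorem IsMarkovChain.ae_mem_eventL_skeleton [IsProbabilityMeasure μ]
    (hX : IsMarkovChain P X μ) (hirr : IsIrreducible P) (haper : IsAperiodic P)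
    (hrec : IsRecurrent P) {m : ℕ} (hm : m ≠ 0) {C : Set S}
    (hC : IsAlmostClosed (skeleton X m) μ C) : ∀ᵐ ω ∂μ, ω ∈ eventL (skeleton X m) C := by
  obtain ⟨j, hj⟩ : C.Nonempty := by
    refine Set.nonempty_iff_ne_empty.2 fun h => hC.1 ?_
    simp [IsTransientSet, eventU, h]
  filter_upwards [hX.ae_frequently_skeleton_eq hirr haper hrec hm j, hC.2.mem_iff] with ω hω hUL
  refine hUL.1 ?_
  exact hω.mono fun n hn => by rw [hn]; exact hj

theorem IsMarkovChain.blackwellNumber_skeleton_ne [IsProbabilityMeasure μ]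
    (hX : IsMarkovChain P X μ) (hirr : IsIrreducible P) (haper : IsAperiodic P)
    (hrec : IsRecurrent P) {m : ℕ} (hm : 1 < m) (Q : S → PMF S) :
    blackwellNumber Q (skeleton X m) μ ≠ m := by
  intro h
  have hne : {b : ℕ∞ | ∃ D : Set (Set S),
      IsBlackwellDecomposition Q (skeleton X m) μ D ∧ b = D.encard}.Nonempty := by
    -- Without decompositions the infimum would be `⊤`, which is not the finite `m`.
    refine Set.nonempty_iff_ne_empty.2 fun hempty => ?_
    rw [blackwellNumber, hempty, sInf_empty] at h
    exact ENat.top_ne_natCast m h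
  obtain ⟨D, hD, hcard⟩ := csInf_mem hne
  rw [← blackwellNumber, h] at hcard
  obtain ⟨C, C', hC, hC', hCC'⟩ := Set.one_lt_encard_iff.1
    (show 1 < D.encard by rw [← hcard]; exact_mod_cast hm)
  have hL := hX.ae_mem_eventL_skeleton hirr haper hrec (by omega) (hD.almostClosed C hC)
  have hL' := hX.ae_mem_eventL_skeleton hirr haper hrec (by omega) (hD.almostClosed C' hC')
  obtain ⟨ω, hω, hω'⟩ := (hL.and hL').exists
  obtain ⟨n, hn, hn'⟩ := (Filter.Eventually.and hω hω').exists
  exact Set.disjoint_left.1 (hD.disjoint C hC C' hC' hCC') hn hn'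

theorem IsMarkovChain.isAsymptoticallyAperiodic_of_isRecurrent [IsProbabilityMeasure μ]
    (hX : IsMarkovChain P X μ) (hirr : IsIrreducible P) (haper : IsAperiodic P)
    (hsimple : IsSimple P X μ) (hrec : IsRecurrent P) : IsAsymptoticallyAperiodic P X μ := by
  refine le_antisymm (sSup_le ?_) (le_sSup ⟨1, le_rfl, ?_, by simp⟩)
  · rintro d ⟨m, hm, hb, rfl⟩
    obtain rfl : m = 1 := by
      by_contra hne
      exact hX.blackwellNumber_skeleton_ne hirr haper hrec (by omega) _ hb
    simp
  -- Simplicity puts `m = 1` in the set, so the supremum is at least `1`.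
  · have hskel : skeleton X 1 = X := by
      funext n
      simp [skeleton]
    rw [nStep_one, hskel, Nat.cast_one]
    exact hsimple

end SamplePaths

end AsymptoticPeriod

theorem mainTheorem5 {S : Type*} [Countable S] {Ω : Type*} [MeasurableSpace Ω]
    (μ : Measure Ω) [IsProbabilityMeasure μ] (P : S → PMF S) (X : ℕ → Ω → S)
    (hX : AsymptoticPeriod.IsMarkovChain P X μ)
    (hirr : AsymptoticPeriod.IsIrreducible P)
    (haper : AsymptoticPeriod.IsAperiodic P)
    (hsimple : AsymptoticPeriod.IsSimple P X μ) :
    (AsymptoticPeriod.IsRecurrent P → AsymptoticPeriod.IsAsymptoticallyAperiodic P X μ) ∧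
      (1 < AsymptoticPeriod.asymptoticPeriod P X μ → AsymptoticPeriod.IsTransient P) := by
  have h := hX.isAsymptoticallyAperiodic_of_isRecurrent hirr haper hsimple
  refine ⟨h, fun hlt => AsymptoticPeriod.isTransient_of_not_isRecurrent hirr fun hrec => ?_⟩
  exact hlt.ne' (h hrec)
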